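/- Write $\omega$ for the least infinite ordinal and $\omega_1$ for the least uncountable ordinal. Assume Ostaszewski's principle $\clubsuit$: there is a family $(S_\alpha)$, indexed by the limit ordinals $\alpha<\omega_1$, such that each $S_\alpha$ is a cofinal subset of $\alpha$ of order type $\omega$, and every uncountable subset of $\omega_1$ includes $S_\alpha$ for some $\alpha$. Then there is a locally compact Hausdorff space $L$ with the following three properties. (1) There is a continuous surjection $\varphi\colon L\to[0,\omega_1)$, where $[0,\omega_1)$ carries the order topology, such that $\varphi^{-1}[\{\alpha\}]$ is finite for every $\alpha<\omega_1$. (2) $L$ has height $\omega$: the least ordinal $\alpha$ with $L^{(\alpha)}=\emptyset$ is $\omega$. Here $L^{(0)}=L$, $L^{(\beta+1)}$ is the set of non-isolated points of the subspace $L^{(\beta)}$, and $L^{(\alpha)}=\bigcap_{\beta<\alpha}L^{(\beta)}$ for limit $\alpha$. (3) $L$ is $3$-diverse at the boundary, in the following sense. Let $K=L\cup\{\infty\}$ be the one-point compactification of $L$, and call two finite tuples of points of $K$ disjoint if they have no coordinate in common. For non-zero $m_1,m_2,m_3\in\mathbb N$ let $K(m_1,m_2,m_3)$ be the set of all $(x_1,x_2,x_3)\in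 K^{m_1}\times K^{m_2}\times K^{m_3}$ such that $x_1,x_2,x_3$ are pairwise disjoint. Let $\Delta(m_1,m_2,m_3)$ be the set of those $(x_1,x_2,x_3)\in K(m_1,m_2,m_3)$ such that all coordinates of $x_1$ are equal, all coordinates of $x_2$ are equal, and all coordinates of $x_3$ are $\infty$. Then for all non-zero $m_1,m_2,m_3\in\mathbb N$, every uncountable subset of $K(m_1,m_2,m_3)$ whose elements are pairwise disjoint when regarded as elements of $K^{m_1+m_2+m_3}$ has an accumulation point (in the product topology) that belongs to $\Delta(m_1,m_2,m_3)$. -/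

import Mathlib

open Set Filter Topology
open scoped Ordinal

/-- Ostaszewski's principle `♣`: there is a family `(S α)`, indexed by the limit ordinals `α < ω₁`,
where `S α` is a cofinal subset of `α` of order type `ω`, such that every uncountable subset of
`ω₁` includes some `S α`. (The values of `S` at other ordinals play no role.) -/
def ClubPrinciple : Prop :=
  ∃ S : Ordinal.{0} → Set Ordinal.{0},
    (∀ α, α < ω₁ → Order.IsSuccLimit α →
      S α ⊆ Iio α ∧ (∀ β < α, ∃ γ ∈ S α, β < γ) ∧ Nonempty (ℕ ≃o S α)) ∧
    ∀ A : Set Ordinal.{0}, A ⊆ Iio ω₁ → ¬ A.Countable →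
      ∃ α, α < ω₁ ∧ Order.IsSuccLimit α ∧ S α ⊆ A

/-- The Cantor-Bendixson derivatives `X^(α)` of a topological space `X`: `X^(0) = X`, `X^(β+1)` is
the set of points of `X^(β)` that are not isolated in `X^(β)`, and intersections are taken at limit
ordinals. -/
noncomputable def cbDerivative (X : Type) [TopologicalSpace X] (α : Ordinal.{0}) : Set X :=
  Ordinal.limitRecOn α
    univ
    (fun _ A => {x ∈ A | AccPt x (𝓟 A)})
    (fun α _ ih => ⋂ (β : Ordinal.{0}) (h : β < α), ih β h)

theorem cbDerivative_zero (X : Type) [TopologicalSpace X] : cbDerivative X 0 = univ := by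
  simp [cbDerivative]

theorem cbDerivative_add_one (X : Type) [TopologicalSpace X] (β : Ordinal.{0}) :
    cbDerivative X (β + 1) = {x ∈ cbDerivative X β | AccPt x (𝓟 (cbDerivative X β))} := by
  unfold cbDerivative
  rw [Ordinal.limitRecOn_add_one]

theorem cbDerivative_limit (X : Type) [TopologicalSpace X] (α : Ordinal.{0})
    (hα : Order.IsSuccLimit α) :
    cbDerivative X α = ⋂ (β : Ordinal.{0}) (_ : β < α), cbDerivative X β := by
  unfold cbDerivative
  rw [Ordinal.limitRecOn_limit (h := hα)]

/-- `X` has height `α`: `α` is the least ordinal with `X^(α) = ∅`. -/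
def HasHeight (X : Type) [TopologicalSpace X] (α : Ordinal.{0}) : Prop :=
  IsLeast {β : Ordinal.{0} | cbDerivative X β = ∅} α

/-- There is a finite-to-one continuous surjection of `L` onto `[0, ω₁)`, the latter carrying its
order topology. -/
def HasFiniteToOneSurjection (L : Type) [TopologicalSpace L] : Prop :=
  ∃ φ : L → Iio (ω₁ : Ordinal.{0}),
    Continuous φ ∧ Function.Surjective φ ∧ ∀ α, (φ ⁻¹' {α}).Finite

/-- `K^{m₁} × K^{m₂} × K^{m₃}`, with the product topology. -/
abbrev TripleProd (K : Type) (m₁ m₂ m₃ : ℕ) : Type :=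
  (Fin m₁ → K) × (Fin m₂ → K) × (Fin m₃ → K)

/-- The set of all coordinates of a triple, seen as a point of `K^{m₁+m₂+m₃}`. -/
def tripleCoords {K : Type} {m₁ m₂ m₃ : ℕ} (p : TripleProd K m₁ m₂ m₃) : Set K :=
  range p.1 ∪ range p.2.1 ∪ range p.2.2

/-- `K(m₁, m₂, m₃)`: the triples `(x₁, x₂, x₃)` such that no two of `x₁`, `x₂`, `x₃` have a
coordinate in common. -/
def disjointTriples (K : Type) (m₁ m₂ m₃ : ℕ) : Set (TripleProd K m₁ m₂ m₃) :=
  {p | Disjoint (range p.1) (range p.2.1) ∧ Disjoint (range p.1) (range p.2.2) ∧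
    Disjoint (range p.2.1) (range p.2.2)}

/-- `Δ(m₁, m₂, m₃)`, for `K = L ∪ {∞}`: the triples `(x₁, x₂, x₃)` in `K(m₁, m₂, m₃)` such that all
coordinates of `x₁` are equal, all coordinates of `x₂` are equal and all coordinates of `x₃` are
`∞`. -/
def boundaryDiagonal (L : Type) (m₁ m₂ m₃ : ℕ) : Set (TripleProd (OnePoint L) m₁ m₂ m₃) :=
  {p | p ∈ disjointTriples (OnePoint L) m₁ m₂ m₃ ∧
    (∀ i j, p.1 i = p.1 j) ∧ (∀ i j, p.2.1 i = p.2.1 j) ∧ (∀ i, p.2.2 i = OnePoint.infty)}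

/-- `L` is 3-diverse at the boundary. -/
def IsThreeDiverseAtBoundary (L : Type) [TopologicalSpace L] : Prop :=
  ∀ m₁ m₂ m₃ : ℕ, m₁ ≠ 0 → m₂ ≠ 0 → m₃ ≠ 0 →
    ∀ Z : Set (TripleProd (OnePoint L) m₁ m₂ m₃),
      Z ⊆ disjointTriples (OnePoint L) m₁ m₂ m₃ →
      (∀ p ∈ Z, ∀ q ∈ Z, p ≠ q → Disjoint (tripleCoords p) (tripleCoords q)) →
      ¬ Z.Countable →
      ∃ p ∈ boundaryDiagonal L m₁ m₂ m₃, AccPt p (𝓟 Z)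

/-!
The space is `L = ω₁ × {0, 1}`, and `φ` is the projection to `ω₁`. Finite tuples of points of `L`
are coded by countable ordinals, so each set `S α` given by `♣` codes a sequence of triples of
finite subsets of `L`. If these triples move up towards level `α` (`Separated`), then `(α, 0)` is
declared to be the limit of their first components and `(α, 1)` that of their second components;
otherwise both points are isolated.

In a locally compact space, declaring that points `y` converge to `x` requires compact
neighbourhoods of the points `y` that converge to `x` with them. These are obtained all at once,
without building the topology by recursion: `z` is in the basic neighbourhood of `x` if it can be
reached from `x` by a path that follows the minimal walk on levels along the ladders
(`LadderSystem.Reach`). The points reachable from `x` form a compact open set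
(`LadderSystem.isOpen_reach`, `LadderSystem.isCompact_reach`), those reachable from `(α, 0)` and
from `(α, 1)` are disjoint (`LadderSystem.Reach.eq_of_level_eq_left`), and the projection to
levels is continuous; hence `L` is Hausdorff and locally compact.

The third components of the triples guessed at `α` converge to `∞`
(`LadderSystem.tendsto_cocompact_of_notMem_target`): if a compact set contained infinitely many of
their points, it would contain a cluster point of them, necessarily of level `α`, but the
neighbourhoods of `(α, 0)` and `(α, 1)` contain none of these points. As every uncountable
pairwise disjoint family of triples can be thinned out so that `♣` guesses a separated part of it
(`exists_good_subset`), this gives diversity.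

For the height to be `ω`, every point must have finite rank. So a guess is only followed if the
ranks of the levels involved are bounded, which costs nothing as an uncountable family has an
uncountable subfamily of bounded rank. Guessing uncountable sets of points of rank at least `n`
yields points of rank at least `n + 1` (`exists_mem_cbDerivative_lt_level`).
-/

/-! ### The space of a ladder system -/

/-- `s` is a cofinal subset of `Iio α` all of whose proper initial segments are finite, that is, one
of order type `ω`. In particular, `α` is a limit. -/
structure IsLadder {Λ : Type*} [LinearOrder Λ] (α : Λ) (s : Set Λ) : Prop where
  nonempty : s.Nonempty
  lt : ∀ β ∈ s, β < α
  exists_gt : ∀ γ < α, ∃ β ∈ s, γ < β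
  finite : ∀ γ < α, (s ∩ Iic γ).Finite

/-- The combinatorial data defining a topology on `Λ × Bool`. Each `α ∈ good` carries a ladder
`rung α`, and the point `(α, i)` is to be a limit of the points of `target (α, i)`, whose levels are
rungs of `α`. The two points of level `α` have disjoint targets. A point whose level is not good has
no targets and will be isolated. -/
structure LadderSystem (Λ : Type*) [LinearOrder Λ] where
  good : Set Λ
  rung : Λ → Set Λ
  target : Λ × Bool → Set (Λ × Bool)
  isLadder : ∀ α ∈ good, IsLadder α (rung α)
  good_of_target : ∀ {x y}, y ∈ target x → x.1 ∈ good
  rung_of_target : ∀ {x y}, y ∈ target x → y.1 ∈ rung x.1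
  disjoint_target : ∀ {α i j}, i ≠ j → Disjoint (target (α, i)) (target (α, j))

namespace LadderSystem

variable {Λ : Type*} [LinearOrder Λ] (D : LadderSystem Λ)

/-- The set `Λ × Bool`, as a synonym carrying the topology determined by the ladder system. -/
def Space (_ : LadderSystem Λ) : Type _ := Λ × Bool

variable {D}

/-- The projection of `Λ × Bool` to `Λ`. -/
def level (x : D.Space) : Λ := x.1

variable (D) in
/-- `D.Reach x z` says that `z` lies in the compact open neighbourhood of `x` that the ladder system
determines: `z` is `x`, or it is reached from some `y ∈ D.target x` whose level is the least rung of
`level x` that is at least `level z`. Thus a path from `x` to `z` follows the minimal walk from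
`level x` to `level z`. -/
inductive Reach : D.Space → D.Space → Prop
  | refl (x : D.Space) : Reach x x
  | step {x y z : D.Space} : y ∈ D.target x → (∀ β ∈ D.rung (level x), level z ≤ β → level y ≤ β) →
      Reach y z → Reach x z

theorem level_lt_of_target {x y : D.Space} (h : y ∈ D.target x) : level y < level x :=
  (D.isLadder _ (D.good_of_target h)).lt _ (D.rung_of_target h)

theorem Reach.level_le {x z : D.Space} (h : D.Reach x z) : level z ≤ level x := by
  induction h with
  | refl => exact le_rfl
  | step h _ _ ih => exact ih.trans (level_lt_of_target h).le

theorem Reach.eq_of_level_eq {x z : D.Space} (h : D.Reach x z) (e : level z = level x) :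
    z = x := by
  cases h with
  | refl => rfl
  | step h _ h' => exact absurd e (h'.level_le.trans_lt (level_lt_of_target h)).ne

theorem Reach.of_target {x y : D.Space} (h : y ∈ D.target x) : D.Reach x y :=
  .step h (fun _ _ h => h) (.refl y)

/-- The level reached by the first step depends only on the levels of the two end points. -/
theorem first_step_level_eq {x x' y y' z : D.Space} (hx : level x = level x')
    (hy : y ∈ D.target x) (hy' : y' ∈ D.target x')
    (hm : ∀ β ∈ D.rung (level x), level z ≤ β → level y ≤ β)
    (hm' : ∀ β ∈ D.rung (level x'), level z ≤ β → level y' ≤ β)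
    (hz : level z ≤ level y) (hz' : level z ≤ level y') : level y = level y' := by
  apply le_antisymm
  · exact hm _ (by rw [hx]; exact D.rung_of_target hy') hz'
  · exact hm' _ (by rw [← hx]; exact D.rung_of_target hy) hz

/-- The neighbourhoods of the two points of a level are disjoint: the first steps from both end at
the same level, so by induction at the same point, while the targets are disjoint. -/
theorem Reach.eq_of_level_eq_left {x z : D.Space} (h : D.Reach x z) :
    ∀ {x' : D.Space}, level x = level x' → D.Reach x' z → x = x' := by
  induction h with
  | refl z => exact fun e h' => h'.eq_of_level_eq e
  | @step x y z hy hm hr ih =>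
    intro x' e h'
    cases h' with
    | refl => exact absurd e (hr.level_le.trans_lt (level_lt_of_target hy)).ne'
    | @step _ y' _ hy' hm' hr' =>
      have := ih (first_step_level_eq e hy hy' hm hm' hr.level_le hr'.level_le) hr'
      subst this
      obtain ⟨a, i⟩ := x
      obtain ⟨a', i'⟩ := x'
      obtain rfl : a = a' := e
      by_contra hne
      have hi : i ≠ i' := fun h => hne (by rw [h])
      exact Set.disjoint_left.1 (D.disjoint_target hi) hy hy'

/-- A set is open if with every point `x` of good level it contains all points reachable from `x`
whose level lies above some `γ < level x`. -/
instance : TopologicalSpace D.Space where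
  IsOpen W := ∀ x ∈ W, level x ∈ D.good → ∃ γ < level x, ∀ z, D.Reach x z → γ < level z → z ∈ W
  isOpen_univ := fun x _ hx => by
    obtain ⟨β, hβ⟩ := (D.isLadder _ hx).nonempty
    exact ⟨β, (D.isLadder _ hx).lt _ hβ, fun _ _ _ => trivial⟩
  isOpen_inter := fun U V hU hV x hx hg => by
    obtain ⟨γ, hγ, h⟩ := hU x hx.1 hg
    obtain ⟨γ', hγ', h'⟩ := hV x hx.2 hg
    exact ⟨max γ γ', max_lt hγ hγ', fun z hz hm =>
      ⟨h z hz ((le_max_left _ _).trans_lt hm), h' z hz ((le_max_right _ _).trans_lt hm)⟩⟩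
  isOpen_sUnion := fun 𝒰 h x ⟨U, hU, hx⟩ hg => by
    obtain ⟨γ, hγ, h⟩ := h U hU x hx hg
    exact ⟨γ, hγ, fun z hz hm => ⟨U, hU, h z hz hm⟩⟩

/-- Any set closed under `D.Reach` is open. -/
theorem isOpen_of_forall_reach {W : Set D.Space} (h : ∀ x ∈ W, ∀ z, D.Reach x z → z ∈ W) :
    IsOpen W := fun x hx hg => by
  obtain ⟨β, hβ⟩ := (D.isLadder _ hg).nonempty
  exact ⟨β, (D.isLadder _ hg).lt _ hβ, fun z hz _ => h x hx z hz⟩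

theorem isOpen_level_le (γ : Λ) : IsOpen {x : D.Space | level x ≤ γ} :=
  isOpen_of_forall_reach fun _ hx _ hz => hz.level_le.trans hx

theorem isOpen_level_lt (γ : Λ) : IsOpen {x : D.Space | level x < γ} :=
  isOpen_of_forall_reach fun _ hx _ hz => hz.level_le.trans_lt hx

theorem isOpen_lt_level (γ : Λ) : IsOpen {x : D.Space | γ < level x} :=
  fun _ hx _ => ⟨γ, hx, fun _ _ h => h⟩

theorem isOpen_reach (x : D.Space) : IsOpen {z | D.Reach x z} := by
  intro w hw hg
  change D.Reach x w at hw
  induction hw with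
  | refl x =>
    obtain ⟨β, hβ⟩ := (D.isLadder _ hg).nonempty
    exact ⟨β, (D.isLadder _ hg).lt _ hβ, fun z hz _ => hz⟩
  | @step x y w hy hm hr ih =>
    obtain ⟨γ, hγ, h⟩ := ih hg
    have hx := D.isLadder _ (D.good_of_target hy)
    have hwx : level w < level x := hr.level_le.trans_lt (level_lt_of_target hy)
    -- Beyond `δ`, the levels below `level w` contain no rung of `level x`.
    obtain ⟨δ, hδ, hδ'⟩ : ∃ δ < level w, γ ≤ δ ∧
        ∀ β ∈ D.rung (level x), β < level w → β ≤ δ := by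
      have hfin : (insert γ (D.rung (level x) ∩ Iio (level w))).Finite :=
        ((hx.finite _ hwx).subset (inter_subset_inter_right _ Iio_subset_Iic_self)).insert _
      obtain ⟨δ, hδ, hmax⟩ := hfin.exists_maximalFor id _ ⟨γ, mem_insert _ _⟩
      have hle : ∀ β ∈ insert γ (D.rung (level x) ∩ Iio (level w)), β ≤ δ := fun β hβ =>
        (le_total β δ).elim id fun h => hmax hβ h
      refine ⟨δ, ?_, hle _ (mem_insert _ _), fun β hβ hβw => hle _ (.inr ⟨hβ, hβw⟩)⟩
      rcases hδ with rfl | hδ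
      exacts [hγ, hδ.2]
    refine ⟨δ, hδ, fun z hz hδz => Reach.step hy (fun β hβ hzβ => hm β hβ ?_)
      (h z hz (hδ'.1.trans_lt hδz))⟩
    by_contra hlt
    exact (hδz.trans_le hzβ).not_ge (hδ'.2 β hβ (not_le.1 hlt))

theorem reach_mem_nhds (x : D.Space) : {z | D.Reach x z} ∈ 𝓝 x :=
  (isOpen_reach x).mem_nhds (.refl x)

instance : T2Space D.Space where
  t2 x y hne := by
    rcases lt_trichotomy (level x) (level y) with h | h | h
    · exact ⟨_, _, isOpen_level_le (level x), isOpen_lt_level (level x), le_rfl, h,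
        Set.disjoint_left.2 fun z (hz : _ ≤ _) (hz' : _ < _) => hz.not_gt hz'⟩
    · exact ⟨_, _, isOpen_reach x, isOpen_reach y, .refl x, .refl y,
        Set.disjoint_left.2 fun z hz hz' => hne (hz.eq_of_level_eq_left h hz')⟩
    · exact ⟨_, _, isOpen_lt_level (level y), isOpen_level_le (level y), h, le_rfl,
        Set.disjoint_left.2 fun z (hz : _ < _) (hz' : _ ≤ _) => hz'.not_gt hz⟩

theorem isClosed_lt_level (γ : Λ) : IsClosed {x : D.Space | γ < level x} := by
  simpa only [← isOpen_compl_iff, compl_ofPred, not_lt] using isOpen_level_le γ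

/-- Below a level less than `level x`, only finitely many points of `D.target x` can be the first
step of a path from `x`. -/
theorem finite_first_steps {x : D.Space} {γ : Λ} (hγ : γ < level x) :
    {y : D.Space | y ∈ D.target x ∧ ∃ z : D.Space, level z ≤ γ ∧
      ∀ β ∈ D.rung (level x), level z ≤ β → level y ≤ β}.Finite := by
  by_cases hg : level x ∈ D.good
  · obtain ⟨δ, hδ, hγδ⟩ := (D.isLadder _ hg).exists_gt γ hγ
    have hfin := (D.isLadder _ hg).finite δ ((D.isLadder _ hg).lt δ hδ)
    refine (hfin.prod (Set.finite_univ (α := Bool))).subset ?_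
    rintro y ⟨hy, z, hz, hm⟩
    exact ⟨⟨D.rung_of_target hy, hm δ hδ (hz.trans hγδ.le)⟩, trivial⟩
  · convert Set.finite_empty
    exact Set.eq_empty_of_forall_notMem fun y hy => hg (D.good_of_target hy.1)

/-- By induction on the level of `x`: an ultrafilter on the set of points reachable from `x` either
contains the points above `γ` for every `γ < level x`, and then it converges to `x`, or it lives on
the points reachable through one of finitely many targets. -/
theorem isCompact_reach [WellFoundedLT Λ] (x : D.Space) : IsCompact {z | D.Reach x z} := by
  induction h : level x using WellFoundedLT.induction generalizing x with
  | ind α ih =>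
  subst h
  rw [isCompact_iff_ultrafilter_le_nhds]
  intro f hf
  rw [le_principal_iff] at hf
  by_cases hlow : ∃ γ < level x, {z : D.Space | level z ≤ γ} ∈ f
  · obtain ⟨γ, hγ, hγf⟩ := hlow
    let A : D.Space → Set D.Space := fun y =>
      {z | D.Reach y z} ∩ {z | ∀ β ∈ D.rung (level x), level z ≤ β → level y ≤ β}
    have hU : (⋃ y ∈ {y : D.Space | y ∈ D.target x ∧ ∃ z : D.Space, level z ≤ γ ∧
      ∀ β ∈ D.rung (level x), level z ≤ β → level y ≤ β}, A y) ∈ f := by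
      filter_upwards [hf, hγf] with z hz hzγ
      cases hz with
      | refl => exact absurd hγ (not_lt.2 hzγ)
      | step hy hm hr => exact mem_biUnion ⟨hy, z, hzγ, hm⟩ ⟨hr, hm⟩
    rw [Ultrafilter.finite_biUnion_mem_iff (finite_first_steps hγ)] at hU
    obtain ⟨y, ⟨hy, -⟩, hA⟩ := hU
    have hclosed : IsClosed {z : D.Space | ∀ β ∈ D.rung (level x), level z ≤ β → level y ≤ β} := by
      have : {z : D.Space | ∀ β ∈ D.rung (level x), level z ≤ β → level y ≤ β} =
          ⋂ β ∈ D.rung (level x), {z : D.Space | level z ≤ β → level y ≤ β} := by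
        ext; simp
      rw [this]
      refine isClosed_biInter fun β _ => ?_
      by_cases hβ : level y ≤ β
      · simp [hβ]
      · simpa [hβ] using isClosed_lt_level β
    obtain ⟨w, hw, hfw⟩ := isCompact_iff_ultrafilter_le_nhds.1
      ((ih (level y) (level_lt_of_target hy) y rfl).inter_right hclosed) f (le_principal_iff.2 hA)
    exact ⟨w, Reach.step hy hw.2 hw.1, hfw⟩
  · refine ⟨x, .refl x, ?_⟩
    intro W hW
    obtain ⟨U, hUW, hU, hxU⟩ := mem_nhds_iff.1 hW
    refine mem_of_superset ?_ hUW
    by_cases hg : level x ∈ D.good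
    · obtain ⟨γ, hγ, h⟩ := hU x hxU hg
      have : {z : D.Space | level z ≤ γ} ∉ f := fun h => hlow ⟨γ, hγ, h⟩
      rw [← Ultrafilter.compl_mem_iff_notMem] at this
      filter_upwards [hf, this] with z hz hzγ using h z hz (not_le.1 hzγ)
    · filter_upwards [hf] with z hz
      cases hz with
      | refl => exact hxU
      | step hy => exact absurd (D.good_of_target hy) hg

instance [WellFoundedLT Λ] : WeaklyLocallyCompactSpace D.Space where
  exists_compact_mem_nhds x := ⟨_, isCompact_reach x, reach_mem_nhds x⟩

theorem continuous_level {M : Type*} [LinearOrder M] [TopologicalSpace M] [OrderTopology M]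
    (e : Λ ≃o M) : Continuous fun x : D.Space => e (level x) := by
  rw [OrderTopology.topology_eq_generate_intervals (α := M), continuous_generateFrom_iff]
  rintro _ ⟨γ, rfl | rfl⟩
  · convert isOpen_lt_level (D := D) (e.symm γ) using 1
    ext x
    exact e.symm_apply_lt.symm
  · convert isOpen_level_lt (D := D) (e.symm γ) using 1
    ext x
    exact e.lt_symm_apply.symm

/-- A family of points of `D.target x` whose levels tend to the level of `x` converges to `x`. -/
theorem tendsto_of_target {ι : Type*} {l : Filter ι} {u : ι → D.Space} {x : D.Space}
    (hu : ∀ i, u i ∈ D.target x) (hl : ∀ γ < level x, ∀ᶠ i in l, γ < level (u i)) :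
    Tendsto u l (𝓝 x) := by
  intro W hW
  obtain ⟨U, hUW, hU, hxU⟩ := mem_nhds_iff.1 hW
  change ∀ᶠ i in l, u i ∈ W
  by_cases hg : level x ∈ D.good
  · obtain ⟨γ, hγ, h⟩ := hU x hxU hg
    filter_upwards [hl γ hγ] with i hi using hUW (h _ (.of_target (hu i)) hi)
  · exact .of_forall fun i => absurd (D.good_of_target (hu i)) hg

/-- Among the points whose level is a rung of `level x`, only those of `D.target x` can be reached
from `x`. -/
theorem Reach.mem_target {x y : D.Space} (h : D.Reach x y) (hy : level y ∈ D.rung (level x))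
    (hne : y ≠ x) : y ∈ D.target x := by
  cases h with
  | refl => exact absurd rfl hne
  | step h hm hr => rwa [hr.eq_of_level_eq (hr.level_le.antisymm (hm _ hy le_rfl))]

/-- A family of points at rungs of `α`, whose levels tend to `α` and which avoids the targets of
the points of level `α`, leaves every compact set. -/
theorem tendsto_cocompact_of_notMem_target {ι : Type*} {l : Filter ι} {u : ι → D.Space} {α : Λ}
    (hα : α ∈ D.good) (hr : ∀ i, level (u i) ∈ D.rung α)
    (hu : ∀ i b, u i ∉ D.target (α, b))
    (hl : ∀ γ < α, ∀ᶠ i in l, γ < level (u i)) :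
    Tendsto u l (cocompact D.Space) := by
  rw [hasBasis_cocompact.tendsto_right_iff]
  intro K hK
  by_contra hfreq
  have hne : (map u l ⊓ 𝓟 K).NeBot := by
    rw [← frequently_mem_iff_neBot]
    exact fun h => hfreq h
  obtain ⟨w, -, hw⟩ := hK (inf_le_right : map u l ⊓ 𝓟 K ≤ 𝓟 K)
  have key : ∀ {W : Set D.Space}, W ∈ 𝓝 w → ∃ᶠ i in l, u i ∈ W := by
    intro W hW
    exact (hw.mono inf_le_left).frequently hW
  have hlt : ∀ i, level (u i) < α := fun i => (D.isLadder α hα).lt _ (hr i)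
  -- A cluster point can only be one of the two points of level `α`, whose neighbourhoods contain
  -- none of the points `u i`.
  have hwα : level w = α := by
    rcases lt_trichotomy (level w) α with h | h | h
    · obtain ⟨i, hi, hi'⟩ := ((key ((isOpen_level_le _).mem_nhds
        (le_refl (level w)))).and_eventually (hl _ h)).exists
      exact absurd hi (not_le.2 hi')
    · exact h
    · obtain ⟨i, hi⟩ := (key ((isOpen_lt_level α).mem_nhds h)).exists
      exact absurd (hlt i) (not_lt.2 (le_of_lt hi))
  obtain ⟨i, hi⟩ := (key (reach_mem_nhds w)).exists
  obtain ⟨a, b⟩ := w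
  obtain rfl : a = α := hwα
  refine hu i b (Reach.mem_target hi (hr i) fun h => ?_)
  exact (hlt i).ne (congrArg level h)

end LadderSystem

/-! ### Guessing triples of finite sets -/

theorem IsLadder.infinite {Λ : Type*} [LinearOrder Λ] {α : Λ} {s : Set Λ} (h : IsLadder α s) :
    s.Infinite := fun hfin => by
  obtain ⟨β, hβ, hmax⟩ := hfin.exists_maximalFor id _ h.nonempty
  obtain ⟨γ, hγ, hlt⟩ := h.exists_gt β (h.lt β hβ)
  exact hlt.not_ge (hmax hγ hlt.le)

/-- Triples of finite sets, which stand for the coordinates of the three parts of a tuple. -/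
abbrev FinsetTriple (X : Type*) : Type _ := Finset X × Finset X × Finset X

namespace FinsetTriple

variable {X : Type*}

/-- The union of the three sets of the triple. -/
def coords (c : FinsetTriple X) : Set X := ↑c.1 ∪ ↑c.2.1 ∪ ↑c.2.2

/-- The first or the second set of the triple. Its points are to converge to `(α, b)`; those of the
third set are to escape to infinity. -/
def component (c : FinsetTriple X) (b : Bool) : Finset X := bif b then c.2.1 else c.1

/-- The three sets of the triple are pairwise disjoint. -/
def IsDisjoint (c : FinsetTriple X) : Prop :=
  Disjoint c.1 c.2.1 ∧ Disjoint c.1 c.2.2 ∧ Disjoint c.2.1 c.2.2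

theorem finite_coords (c : FinsetTriple X) : c.coords.Finite :=
  ((c.1.finite_toSet.union c.2.1.finite_toSet).union c.2.2.finite_toSet)

theorem mem_coords_of_mem_component {c : FinsetTriple X} {b : Bool} {x : X}
    (h : x ∈ c.component b) : x ∈ c.coords := by
  cases b
  exacts [.inl (.inl h), .inl (.inr h)]

theorem IsDisjoint.disjoint_component {c : FinsetTriple X} (h : c.IsDisjoint) {b b' : Bool}
    (hb : b ≠ b') : Disjoint (c.component b) (c.component b') := by
  cases b <;> cases b'
  exacts [absurd rfl hb, h.1, h.1.symm, absurd rfl hb]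

theorem IsDisjoint.disjoint_component_last {c : FinsetTriple X} (h : c.IsDisjoint) (b : Bool) :
    Disjoint (c.component b) c.2.2 := by
  cases b
  exacts [h.2.1, h.2.2]

end FinsetTriple

section Block

variable {Λ : Type*} (d : Λ → FinsetTriple (Λ × Bool))

/-- The code `ξ` of a triple together with the levels of the points of the triple. -/
def block (ξ : Λ) : Set Λ := insert ξ (Prod.fst '' (d ξ).coords)

variable {d}

theorem finite_block (ξ : Λ) : (block d ξ).Finite :=
  ((d ξ).finite_coords.image _).insert ξ

theorem self_mem_block (ξ : Λ) : ξ ∈ block d ξ := mem_insert _ _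

theorem mem_block_of_mem_coords {ξ : Λ} {y : Λ × Bool} (h : y ∈ (d ξ).coords) :
    y.1 ∈ block d ξ := .inr ⟨y, h, rfl⟩

end Block

section Guessing

variable {Λ : Type*} [LinearOrder Λ] (S : Λ → Set Λ) (d : Λ → FinsetTriple (Λ × Bool))

/-- The union of the blocks of the codes in `S α`: the ladder that will be used at level `α`. -/
def rungs (α : Λ) : Set Λ := ⋃ ξ ∈ S α, block d ξ

/-- `S α` is a ladder whose elements code disjoint triples, with blocks that follow one another in
increasing order. Then the union of the blocks is a ladder, too. -/
structure Separated (α : Λ) : Prop where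
  isLadder : IsLadder α (S α)
  block_lt : ∀ ξ ∈ S α, ∀ ξ' ∈ S α, ξ < ξ' → ∀ β ∈ block d ξ, ∀ β' ∈ block d ξ', β < β'
  isDisjoint : ∀ ξ ∈ S α, (d ξ).IsDisjoint

variable {S d}

namespace Separated

variable {α : Λ}

theorem finite_not_lt_block (h : Separated S d α) {γ : Λ} (hγ : γ < α) :
    {ξ : S α | ¬ ∀ β ∈ block d ξ, γ < β}.Finite := by
  obtain ⟨δ, hδ, hγδ⟩ := h.isLadder.exists_gt γ hγ
  refine Set.Finite.of_finite_image (f := Subtype.val)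
    ((h.isLadder.finite δ (h.isLadder.lt δ hδ)).subset ?_) Subtype.val_injective.injOn
  rintro _ ⟨⟨ξ, hξ⟩, hlt, rfl⟩
  refine ⟨hξ, not_lt.1 fun hδξ => hlt fun β hβ => ?_⟩
  exact hγδ.trans (h.block_lt δ hδ ξ hξ hδξ δ (self_mem_block δ) β hβ)

theorem eventually_lt_block (h : Separated S d α) {γ : Λ} (hγ : γ < α) :
    ∀ᶠ ξ : S α in cofinite, ∀ β ∈ block d ξ, γ < β :=
  h.finite_not_lt_block hγ

theorem neBot_cofinite (h : Separated S d α) : (cofinite : Filter (S α)).NeBot :=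
  have := h.isLadder.infinite.to_subtype
  inferInstance

theorem isLadder_rungs (h : Separated S d α) : IsLadder α (rungs S d α) where
  nonempty := by
    obtain ⟨ξ, hξ⟩ := h.isLadder.nonempty
    exact ⟨ξ, mem_biUnion hξ (self_mem_block ξ)⟩
  lt := by
    intro β hβ
    obtain ⟨ξ, hξ, hβ⟩ := mem_iUnion₂.1 hβ
    obtain ⟨ξ', hξ', hlt⟩ := h.isLadder.exists_gt ξ (h.isLadder.lt ξ hξ)
    exact (h.block_lt ξ hξ ξ' hξ' hlt β hβ ξ' (self_mem_block ξ')).trans (h.isLadder.lt ξ' hξ')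
  exists_gt := by
    intro γ hγ
    obtain ⟨ξ, hξ, hlt⟩ := h.isLadder.exists_gt γ hγ
    exact ⟨ξ, mem_biUnion hξ (self_mem_block ξ), hlt⟩
  finite := by
    intro γ hγ
    refine ((h.finite_not_lt_block hγ).biUnion fun ξ _ => finite_block (d := d) ξ.1).subset ?_
    rintro β ⟨hβ, hβγ⟩
    obtain ⟨ξ, hξ, hβ⟩ := mem_iUnion₂.1 hβ
    exact mem_biUnion (x := (⟨ξ, hξ⟩ : S α)) (fun hlt => (hlt β hβ).not_ge hβγ) hβ

theorem eq_of_fst_eq (h : Separated S d α) {ξ ξ' : Λ} (hξ : ξ ∈ S α) (hξ' : ξ' ∈ S α)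
    {y y' : Λ × Bool} (hy : y ∈ (d ξ).coords) (hy' : y' ∈ (d ξ').coords) (e : y.1 = y'.1) :
    ξ = ξ' := by
  rcases lt_trichotomy ξ ξ' with hlt | rfl | hlt
  · exact absurd e (h.block_lt ξ hξ ξ' hξ' hlt _ (mem_block_of_mem_coords hy) _
      (mem_block_of_mem_coords hy')).ne
  · rfl
  · exact absurd e (h.block_lt ξ' hξ' ξ hξ hlt _ (mem_block_of_mem_coords hy') _
      (mem_block_of_mem_coords hy)).ne'

end Separated

theorem exists_forall_lt_of_countable [Uncountable Λ] (hc : ∀ γ : Λ, (Iic γ).Countable)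
    {s : Set Λ} (hs : s.Countable) : ∃ γ, ∀ β ∈ s, β < γ := by
  by_contra! h
  refine not_countable_univ (α := Λ) ((hs.biUnion fun γ _ => hc γ).mono fun γ _ => ?_)
  obtain ⟨β, hβ, hle⟩ := h γ
  exact mem_biUnion hβ hle

/-- Only countably many members of a pairwise disjoint family of triples come near a given initial
segment. -/
theorem countable_not_lt_block (hc : ∀ γ : Λ, (Iic γ).Countable) {𝒵 : Set Λ}
    (hdisj : ∀ ξ ∈ 𝒵, ∀ ξ' ∈ 𝒵, ξ ≠ ξ' → Disjoint (d ξ).coords (d ξ').coords) (γ : Λ) :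
    {ξ ∈ 𝒵 | ¬ ∀ β ∈ block d ξ, γ < β}.Countable := by
  have hcount : (Iic γ ×ˢ (univ : Set Bool)).Countable := (hc γ).prod (Set.to_countable _)
  refine ((hc γ).union (hcount.biUnion (t := fun y _ => {ξ ∈ 𝒵 | y ∈ (d ξ).coords})
    fun y _ => Set.Subsingleton.countable ?_)).mono ?_
  · rintro ξ ⟨hξ, hy⟩ ξ' ⟨hξ', hy'⟩
    by_contra hne
    exact Set.disjoint_left.1 (hdisj ξ hξ ξ' hξ' hne) hy hy'
  · rintro ξ ⟨hξ, h⟩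
    push Not at h
    obtain ⟨β, rfl | ⟨y, hy, rfl⟩, hβ⟩ := h
    · exact .inl hβ
    · exact .inr (mem_biUnion (x := y) ⟨hβ, trivial⟩ ⟨hξ, hy⟩)

/-- An uncountable pairwise disjoint family of triples can be thinned out so that the blocks follow
one another: any countable chain of blocks has a bound, hence extends. -/
theorem exists_uncountable_chain [Uncountable Λ] (hc : ∀ γ : Λ, (Iic γ).Countable) {𝒵 : Set Λ}
    (h𝒵 : ¬ 𝒵.Countable)
    (hdisj : ∀ ξ ∈ 𝒵, ∀ ξ' ∈ 𝒵, ξ ≠ ξ' → Disjoint (d ξ).coords (d ξ').coords) :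
    ∃ A ⊆ 𝒵, ¬ A.Countable ∧
      ∀ ξ ∈ A, ∀ ξ' ∈ A, ξ < ξ' → ∀ β ∈ block d ξ, ∀ β' ∈ block d ξ', β < β' := by
  let r : 𝒵 → 𝒵 → Prop := fun ξ ξ' => ∀ β ∈ block d ξ, ∀ β' ∈ block d ξ', β < β'
  obtain ⟨hchain, hmax⟩ : IsMaxChain r (maxChain r) := maxChain_spec
  refine ⟨Subtype.val '' maxChain r, by simp, fun hA => ?_, ?_⟩
  · obtain ⟨γ, hγ⟩ := exists_forall_lt_of_countable hc
      (hA.biUnion fun ξ _ => (finite_block (d := d) ξ).countable)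
    obtain ⟨ξ, hξ, hlt⟩ : ∃ ξ ∈ 𝒵, ∀ β ∈ block d ξ, γ < β := by
      by_contra! h
      refine h𝒵 ((countable_not_lt_block hc hdisj γ).mono fun ξ hξ => show ξ ∈ 𝒵 ∧ _ from ⟨hξ, ?_⟩)
      push Not
      exact h ξ hξ
    have hins := hmax (hchain.insert (a := (⟨ξ, hξ⟩ : 𝒵)) fun ξ' hξ' _ =>
      .inr fun β hβ β' hβ' =>
        (hγ β (mem_biUnion (mem_image_of_mem _ hξ') hβ)).trans (hlt β' hβ')) (subset_insert _ _)
    have hmem : (⟨ξ, hξ⟩ : 𝒵) ∈ maxChain r := by rw [hins]; exact mem_insert _ _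
    exact (hlt ξ (self_mem_block ξ)).not_gt
      (hγ ξ (mem_biUnion (mem_image_of_mem _ hmem) (self_mem_block ξ)))
  · rintro _ ⟨ξ, hξ, rfl⟩ _ ⟨ξ', hξ', rfl⟩ hlt
    refine (hchain hξ hξ' fun h => hlt.ne (congrArg _ h)).resolve_right fun h => ?_
    exact hlt.not_gt (h _ (self_mem_block _) _ (self_mem_block _))

variable (S d) in
open Classical in
/-- A bound for the Cantor-Bendixson rank of the points of level `α`. It is positive only if `S α`
is separated and the heights of the rungs of `α` are bounded; the latter is what keeps it finite. -/
noncomputable def height [WellFoundedLT Λ] (α : Λ) : ℕ :=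
  if Separated S d α ∧ BddAbove {n | ∃ β, ∃ _ : β < α, β ∈ rungs S d α ∧ n = height β} then
    sSup {n | ∃ β, ∃ _ : β < α, β ∈ rungs S d α ∧ n = height β} + 1
  else 0
termination_by wellFounded_lt.wrap α

variable [WellFoundedLT Λ]

variable (S d) in
/-- The ladder system that at each level `α` follows the triples coded by `S α`, if these are
separated and of bounded height: the first components of the triples are made to converge to
`(α, false)`, the second ones to `(α, true)`. -/
noncomputable def guessingSystem : LadderSystem Λ where
  good := {α | Separated S d α ∧ ∃ N, ∀ β ∈ rungs S d α, height S d β ≤ N}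
  rung := rungs S d
  target x := {y | (Separated S d x.1 ∧ ∃ N, ∀ β ∈ rungs S d x.1, height S d β ≤ N) ∧
    ∃ ξ ∈ S x.1, y ∈ (d ξ).component x.2}
  isLadder _ h := h.1.isLadder_rungs
  good_of_target h := h.1
  rung_of_target := fun ⟨_, _, hξ, hy⟩ =>
    mem_biUnion hξ (mem_block_of_mem_coords (FinsetTriple.mem_coords_of_mem_component hy))
  disjoint_target := fun {α i j} hij => Set.disjoint_left.2 <| by
    rintro y ⟨h, ξ, hξ, hy⟩ ⟨-, ξ', hξ', hy'⟩
    obtain rfl := h.1.eq_of_fst_eq hξ hξ' (FinsetTriple.mem_coords_of_mem_component hy)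
      (FinsetTriple.mem_coords_of_mem_component hy') rfl
    exact Finset.disjoint_left.1 ((h.1.isDisjoint ξ hξ).disjoint_component hij) hy hy'

theorem mem_good {α : Λ} : α ∈ (guessingSystem S d).good ↔
    Separated S d α ∧ ∃ N, ∀ β ∈ rungs S d α, height S d β ≤ N := Iff.rfl

theorem mem_target {α : Λ} (hα : α ∈ (guessingSystem S d).good) {ξ : Λ} (hξ : ξ ∈ S α) {b : Bool}
    {y : Λ × Bool} (hy : y ∈ (d ξ).component b) : y ∈ (guessingSystem S d).target (α, b) :=
  ⟨hα, ξ, hξ, hy⟩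

theorem notMem_target {α : Λ} {ξ : Λ} (hξ : ξ ∈ S α) (b : Bool)
    {y : Λ × Bool} (hy : y ∈ (d ξ).2.2) : y ∉ (guessingSystem S d).target (α, b) := by
  rintro ⟨h, ξ', hξ', hy'⟩
  obtain rfl := h.1.eq_of_fst_eq hξ' hξ (FinsetTriple.mem_coords_of_mem_component hy')
    (.inr hy) rfl
  exact Finset.disjoint_left.1 ((h.1.isDisjoint _ hξ).disjoint_component_last b) hy' hy

theorem height_lt_of_target {x y : (guessingSystem S d).Space}
    (h : y ∈ (guessingSystem S d).target x) :
    height S d (LadderSystem.level y) < height S d (LadderSystem.level x) := by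
  obtain ⟨⟨hs, N, hN⟩, -⟩ := id h
  have hb : BddAbove {n | ∃ β, ∃ _ : β < LadderSystem.level x,
      β ∈ rungs S d (LadderSystem.level x) ∧ n = height S d β} := by
    refine ⟨N, ?_⟩
    rintro _ ⟨β, -, hβ, rfl⟩
    exact hN β hβ
  conv_rhs => rw [height]
  rw [if_pos ⟨hs, hb⟩, Nat.lt_succ_iff]
  exact le_csSup hb ⟨_, LadderSystem.level_lt_of_target h,
    (guessingSystem S d).rung_of_target h, rfl⟩

/-- Triples are finite and heights are natural numbers, so some bound works for uncountably many. -/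
theorem exists_uncountable_height_le {𝒵 : Set Λ} (h𝒵 : ¬ 𝒵.Countable) :
    ∃ N, ¬ {ξ ∈ 𝒵 | ∀ β ∈ block d ξ, height S d β ≤ N}.Countable := by
  by_contra! h
  refine h𝒵 ((Set.countable_iUnion h).mono fun ξ hξ => ?_)
  obtain ⟨N, hN⟩ := ((finite_block (d := d) ξ).image (height S d)).bddAbove
  exact mem_iUnion.2 ⟨N, hξ, fun β hβ => hN (mem_image_of_mem _ hβ)⟩

/-- Every uncountable pairwise disjoint family of disjoint triples is followed by the ladder system
at some level. -/
theorem exists_good_subset [Uncountable Λ] (hc : ∀ γ : Λ, (Iic γ).Countable)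
    (hS : ∀ A : Set Λ, ¬ A.Countable → ∃ α, IsLadder α (S α) ∧ S α ⊆ A) {𝒵 : Set Λ}
    (h𝒵 : ¬ 𝒵.Countable) (hd : ∀ ξ ∈ 𝒵, (d ξ).IsDisjoint)
    (hdisj : ∀ ξ ∈ 𝒵, ∀ ξ' ∈ 𝒵, ξ ≠ ξ' → Disjoint (d ξ).coords (d ξ').coords) :
    ∃ α ∈ (guessingSystem S d).good, S α ⊆ 𝒵 := by
  obtain ⟨N, hN⟩ := exists_uncountable_height_le (S := S) (d := d) h𝒵
  obtain ⟨A, hA, hAunc, hlt⟩ := exists_uncountable_chain (d := d) hc hN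
    fun ξ hξ ξ' hξ' => hdisj ξ hξ.1 ξ' hξ'.1
  obtain ⟨α, hα, hSA⟩ := hS A hAunc
  refine ⟨α, ⟨⟨hα, fun ξ hξ ξ' hξ' => hlt ξ (hSA hξ) ξ' (hSA hξ'),
    fun ξ hξ => hd ξ (hA (hSA hξ)).1⟩, N, fun β hβ => ?_⟩, fun ξ hξ => (hA (hSA hξ)).1⟩
  obtain ⟨ξ, hξ, hβ⟩ := mem_iUnion₂.1 hβ
  exact (hA (hSA hξ)).2 β hβ

end Guessing

/-! ### Accumulation points and Cantor-Bendixson derivatives -/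

theorem accPt_of_tendsto {X ι : Type*} [TopologicalSpace X] {l : Filter ι} [l.NeBot] {u : ι → X}
    {x : X} {A : Set X} (hu : Tendsto u l (𝓝 x)) (hne : ∀ i, u i ≠ x) (hA : ∀ i, u i ∈ A) :
    AccPt x (𝓟 A) :=
  accPt_iff_frequently.2 <| hu.frequently (Eventually.of_forall fun i => ⟨hne i, hA i⟩).frequently

theorem isClosed_cbDerivative_natCast {X : Type} [TopologicalSpace X] [T1Space X] (n : ℕ) :
    IsClosed (cbDerivative X n) := by
  induction n with
  | zero =>
    rw [Nat.cast_zero, cbDerivative_zero]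
    exact isClosed_univ
  | succ n ih =>
    rw [Nat.cast_succ, cbDerivative_add_one]
    exact ih.inter (isClosed_derivedSet _)

/-- If every point has a neighbourhood in which it is the unique point of largest value of `r`, then
`r` bounds the Cantor-Bendixson rank. -/
theorem mem_cbDerivative_natCast {X : Type} [TopologicalSpace X] (r : X → ℕ)
    (hr : ∀ x, ∃ U ∈ 𝓝 x, ∀ y ∈ U, y ≠ x → r y < r x) (n : ℕ) :
    ∀ x ∈ cbDerivative X n, n ≤ r x := by
  induction n with
  | zero => simp
  | succ n ih =>
    intro x hx
    rw [Nat.cast_succ, cbDerivative_add_one] at hx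
    obtain ⟨U, hU, hlt⟩ := hr x
    obtain ⟨y, ⟨hne, hy⟩, hyU⟩ := ((accPt_iff_frequently.1 hx.2).and_eventually hU).exists
    exact (ih y hy).trans_lt (hlt y hyU hne)

theorem hasHeight_omega0 {X : Type} [TopologicalSpace X]
    (hne : ∀ n : ℕ, (cbDerivative X n).Nonempty) (r : X → ℕ)
    (hr : ∀ x, ∃ U ∈ 𝓝 x, ∀ y ∈ U, y ≠ x → r y < r x) : HasHeight X Ordinal.omega0 := by
  constructor
  · change cbDerivative X Ordinal.omega0 = ∅
    rw [cbDerivative_limit _ _ Ordinal.isSuccLimit_omega0]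
    refine Set.eq_empty_of_forall_notMem fun x hx => ?_
    have := mem_cbDerivative_natCast r hr (r x + 1) x
      (mem_iInter₂.1 hx _ (Ordinal.natCast_lt_omega0 _))
    omega
  · intro β hβ
    by_contra hlt
    obtain ⟨n, rfl⟩ := Ordinal.lt_omega0.1 (not_le.1 hlt)
    exact (hne n).ne_empty hβ

/-! ### The index set `ω₁` -/

/-- `♣`, transferred to the type `ω₁.ToType`, which lives in `Type`. -/
theorem ClubPrinciple.exists_ladders (h : ClubPrinciple) :
    ∃ S : (ω₁ : Ordinal.{0}).ToType → Set (ω₁ : Ordinal.{0}).ToType,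
      ∀ A : Set (ω₁ : Ordinal.{0}).ToType, ¬ A.Countable → ∃ α, IsLadder α (S α) ∧ S α ⊆ A := by
  obtain ⟨S, hS, hguess⟩ := h
  let e : Iio (ω₁ : Ordinal.{0}) ≃o (ω₁ : Ordinal.{0}).ToType := Ordinal.ToType.mk
  let f : (ω₁ : Ordinal.{0}).ToType → Ordinal.{0} := fun a => e.symm a
  have hf : StrictMono f := fun a b hab => e.symm.strictMono hab
  have hfr : ∀ β < (ω₁ : Ordinal.{0}), ∃ a, f a = β := fun β hβ =>
    ⟨e ⟨β, hβ⟩, by simp [f]⟩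
  refine ⟨fun α => f ⁻¹' S (f α), fun A hA => ?_⟩
  obtain ⟨α, hα, hlim, hSA⟩ := hguess (f '' A)
    (by rintro _ ⟨a, -, rfl⟩; exact (e.symm a).2)
    (fun h => hA (countable_of_injective_of_countable_image hf.injective.injOn h))
  obtain ⟨a, rfl⟩ := hfr α hα
  obtain ⟨hsub, hcof, ⟨g⟩⟩ := hS _ hα hlim
  have hgt : ∀ γ < a, ∃ β ∈ f ⁻¹' S (f a), γ < β := by
    intro γ hγ
    obtain ⟨β, hβ, hlt⟩ := hcof (f γ) (hf hγ)
    obtain ⟨b, rfl⟩ := hfr β ((hsub hβ).trans hα)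
    exact ⟨b, hβ, hf.lt_iff_lt.1 hlt⟩
  refine ⟨a, ⟨?_, fun β hβ => hf.lt_iff_lt.1 (hsub hβ), hgt, ?_⟩, ?_⟩
  · obtain ⟨b, hb⟩ := hfr (g 0) ((hsub (g 0).2).trans hα)
    exact ⟨b, by rw [mem_preimage, hb]; exact (g 0).2⟩
  · intro γ hγ
    obtain ⟨β, hβ, hlt⟩ := hgt γ hγ
    refine Set.Finite.of_finite_image (f := f) (((finite_Iic (g.symm ⟨_, hβ⟩)).image
      fun n => (g n : Ordinal)).subset ?_) hf.injective.injOn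
    rintro _ ⟨b, ⟨hb, hbγ⟩, rfl⟩
    refine ⟨g.symm ⟨_, hb⟩, ?_, by simp⟩
    exact g.symm.monotone (hf.monotone (hbγ.trans hlt.le))
  · intro b hb
    obtain ⟨b', hb', h⟩ := hSA hb
    rwa [← hf.injective h]

instance : Uncountable (ω₁ : Ordinal.{0}).ToType := by
  rw [← Cardinal.aleph0_lt_mk_iff, Cardinal.mk_toType]
  simp

theorem countable_Iic_toType_omega_one (γ : (ω₁ : Ordinal.{0}).ToType) : (Iic γ).Countable := by
  rw [← Iio_insert]
  refine Set.Countable.insert _ ?_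
  rw [← Cardinal.le_aleph0_iff_set_countable, ← Cardinal.lt_aleph_one_iff]
  have := Cardinal.mk_Iio_lt γ (by simp)
  simpa using this

theorem nonempty_equiv_finsetTriple (X : Type*) [Infinite X] :
    Nonempty (X ≃ FinsetTriple (X × Bool)) := by
  rw [← Cardinal.eq]
  have h := Cardinal.aleph0_le_mk X
  have h2 : Cardinal.mk X * 2 = Cardinal.mk X :=
    Cardinal.mul_eq_left h (Cardinal.ofNat_lt_aleph0.le.trans h) two_ne_zero
  simp [h2, Cardinal.mul_eq_self h]

/-! ### Height and diversity of the space of the guessing system -/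

section Diversity

variable {Λ : Type} [LinearOrder Λ] [WellFoundedLT Λ] {S : Λ → Set Λ}
  {d : Λ ≃ FinsetTriple (Λ × Bool)}

open LadderSystem

theorem exists_nhds_height_lt (x : (guessingSystem S d).Space) :
    ∃ U ∈ 𝓝 x, ∀ y ∈ U, y ≠ x → height S d (level y) < height S d (level x) := by
  refine ⟨_, reach_mem_nhds x, fun y hy => ?_⟩
  change (guessingSystem S d).Reach x y at hy
  induction hy with
  | refl => exact fun h => absurd rfl h
  | @step x y z hy _ _ ih =>
    intro _
    by_cases hzy : z = y
    · exact hzy ▸ height_lt_of_target hy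
    · exact (ih hzy).trans (height_lt_of_target hy)

theorem eventually_lt_level {α : Λ} (hα : α ∈ (guessingSystem S d).good)
    {u : S α → (guessingSystem S d).Space} (hu : ∀ ξ : S α, u ξ ∈ (d ξ).coords) :
    ∀ γ < α, ∀ᶠ ξ in cofinite, γ < level (u ξ) := fun _ hγ =>
  (mem_good.1 hα).1.eventually_lt_block hγ |>.mono fun ξ h => h _ (mem_block_of_mem_coords (hu ξ))

theorem tendsto_of_mem_component {α : Λ} (hα : α ∈ (guessingSystem S d).good) {b : Bool}
    {u : S α → (guessingSystem S d).Space} (hu : ∀ ξ : S α, u ξ ∈ (d ξ).component b) :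
    Tendsto u cofinite (𝓝 ((α, b) : (guessingSystem S d).Space)) :=
  tendsto_of_target (fun ξ => mem_target hα ξ.2 (hu ξ))
    (eventually_lt_level hα fun ξ => FinsetTriple.mem_coords_of_mem_component (hu ξ))

theorem tendsto_cocompact_of_mem_last {α : Λ} (hα : α ∈ (guessingSystem S d).good)
    {u : S α → (guessingSystem S d).Space} (hu : ∀ ξ : S α, u ξ ∈ (d ξ).2.2) :
    Tendsto u cofinite (cocompact (guessingSystem S d).Space) :=
  tendsto_cocompact_of_notMem_target hα
    (fun ξ => mem_biUnion ξ.2 (mem_block_of_mem_coords (.inr (hu ξ))))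
    (fun ξ b => notMem_target ξ.2 b (hu ξ)) (eventually_lt_level hα fun ξ => .inr (hu ξ))

/-- Each finite Cantor-Bendixson derivative has points of arbitrarily high level: guess uncountably
many points of the previous one, coded as triples `({x}, ∅, ∅)`. -/
theorem exists_mem_cbDerivative_lt_level [Uncountable Λ] (hc : ∀ γ : Λ, (Iic γ).Countable)
    (hS : ∀ A : Set Λ, ¬ A.Countable → ∃ α, IsLadder α (S α) ∧ S α ⊆ A) (n : ℕ) :
    ∀ γ : Λ, ∃ x ∈ cbDerivative (guessingSystem S d).Space n, γ < level x := by
  induction n with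
  | zero =>
    intro γ
    obtain ⟨δ, hδ⟩ := exists_forall_lt_of_countable hc (countable_singleton γ)
    refine ⟨((δ, false) : Λ × Bool), ?_, hδ γ rfl⟩
    rw [Nat.cast_zero, cbDerivative_zero]
    trivial
  | succ n ih =>
    intro γ
    let X : Set (guessingSystem S d).Space :=
      {x ∈ cbDerivative (guessingSystem S d).Space n | γ < level x}
    let c : (guessingSystem S d).Space → Λ := fun x => d.symm ({x}, ∅, ∅)
    have hcinj : Function.Injective c := fun x y h =>
      Finset.singleton_injective (Prod.ext_iff.1 (d.symm.injective h)).1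
    have hX : ¬ X.Countable := fun hX => by
      obtain ⟨δ, hδ⟩ := exists_forall_lt_of_countable hc
        ((hX.image level).union (countable_singleton γ))
      obtain ⟨x, hx, hlt⟩ := ih δ
      exact hlt.not_gt (hδ _ (.inl ⟨x, ⟨hx, (hδ γ (.inr rfl)).trans hlt⟩, rfl⟩))
    obtain ⟨α, hα, hSα⟩ := exists_good_subset (S := S) (d := d) hc hS (𝒵 := c '' X)
      (fun h => hX (countable_of_injective_of_countable_image hcinj.injOn h))
      (by rintro _ ⟨x, -, rfl⟩; simp [c, FinsetTriple.IsDisjoint])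
      (by
        rintro _ ⟨x, -, rfl⟩ _ ⟨y, -, rfl⟩ hne
        have : x ≠ y := fun h => hne (h ▸ rfl)
        simp only [c, Equiv.apply_symm_apply, FinsetTriple.coords, Finset.coe_empty, union_empty]
        exact Finset.disjoint_coe.2 (Finset.disjoint_singleton.2 this))
    choose u huX hu using fun ξ : S α => hSα ξ.2
    have hmem : ∀ ξ : S α, u ξ ∈ (d ξ).component false := fun ξ => by
      rw [← hu ξ, Equiv.apply_symm_apply]
      exact Finset.mem_singleton_self (u ξ)
    have hlt : ∀ ξ : S α, level (u ξ) < α := fun ξ =>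
      level_lt_of_target (x := ((α, false) : Λ × Bool)) (mem_target hα ξ.2 (hmem ξ))
    have := (mem_good.1 hα).1.neBot_cofinite
    refine ⟨((α, false) : Λ × Bool), ?_, ?_⟩
    · rw [Nat.cast_succ, cbDerivative_add_one]
      have hacc := accPt_of_tendsto (tendsto_of_mem_component hα hmem)
        (fun ξ h => (hlt ξ).ne (congrArg level h)) fun ξ => (huX ξ).1
      exact ⟨(isClosed_cbDerivative_natCast n).closure_subset
        (mem_closure_iff_clusterPt.2 hacc.clusterPt), hacc⟩
    · obtain ⟨ξ, hξ⟩ := (mem_good.1 hα).1.isLadder.nonempty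
      exact (huX ⟨ξ, hξ⟩).2.trans (hlt ⟨ξ, hξ⟩)

/-- The finite set of the coordinates other than `∞` of a tuple. -/
noncomputable def finsetOfTuple {X : Type*} {m : ℕ} (f : Fin m → OnePoint X) : Finset X :=
  ((finite_range f).preimage OnePoint.coe_injective.injOn).toFinset

theorem mem_finsetOfTuple {X : Type*} {m : ℕ} {f : Fin m → OnePoint X} {x : X} :
    x ∈ finsetOfTuple f ↔ (x : OnePoint X) ∈ range f := by
  simp [finsetOfTuple]

theorem disjoint_finsetOfTuple {X : Type*} {m n : ℕ} {f : Fin m → OnePoint X}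
    {g : Fin n → OnePoint X} (h : Disjoint (range f) (range g)) :
    Disjoint (finsetOfTuple f) (finsetOfTuple g) :=
  Finset.disjoint_left.2 fun _ hf hg =>
    Set.disjoint_left.1 h (mem_finsetOfTuple.1 hf) (mem_finsetOfTuple.1 hg)

/-- The sets of coordinates other than `∞` of the three parts of a triple of tuples. -/
noncomputable def finsetsOfTriple {X : Type} {m₁ m₂ m₃ : ℕ}
    (p : TripleProd (OnePoint X) m₁ m₂ m₃) : FinsetTriple X :=
  (finsetOfTuple p.1, finsetOfTuple p.2.1, finsetOfTuple p.2.2)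

theorem mem_coords_finsetsOfTriple {X : Type} {m₁ m₂ m₃ : ℕ}
    {p : TripleProd (OnePoint X) m₁ m₂ m₃} {x : X} :
    x ∈ (finsetsOfTriple p).coords ↔ (x : OnePoint X) ∈ tripleCoords p := by
  simp only [FinsetTriple.coords, finsetsOfTriple, tripleCoords, mem_union, Finset.mem_coe,
    mem_finsetOfTuple]

theorem isThreeDiverseAtBoundary [Uncountable Λ] (hc : ∀ γ : Λ, (Iic γ).Countable)
    (hS : ∀ A : Set Λ, ¬ A.Countable → ∃ α, IsLadder α (S α) ∧ S α ⊆ A) :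
    IsThreeDiverseAtBoundary (guessingSystem S d).Space := by
  intro m₁ m₂ m₃ h₁ h₂ h₃ Z hZ hdisj hunc
  -- By disjointness, at most one member of `Z` has `∞` among its coordinates; it can be discarded.
  let Z' := {p ∈ Z | OnePoint.infty ∉ tripleCoords p}
  have hZ' : ¬ Z'.Countable := fun h => by
    refine hunc ((h.union (t := {p ∈ Z | OnePoint.infty ∈ tripleCoords p})
      (Set.Subsingleton.countable ?_)).mono fun p hp => ?_)
    · rintro p ⟨hp, hp'⟩ q ⟨hq, hq'⟩
      by_contra hne
      exact Set.disjoint_left.1 (hdisj p hp q hq hne) hp' hq'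
    · by_cases h : OnePoint.infty ∈ tripleCoords p
      exacts [.inr ⟨hp, h⟩, .inl ⟨hp, h⟩]
  let c : TripleProd (OnePoint (guessingSystem S d).Space) m₁ m₂ m₃ → Λ :=
    fun p => d.symm (finsetsOfTriple p)
  have hdc : ∀ p, d (c p) = finsetsOfTriple p := fun p => d.apply_symm_apply _
  have hdisj' : ∀ p ∈ Z', ∀ q ∈ Z', p ≠ q → Disjoint (d (c p)).coords (d (c q)).coords := by
    intro p hp q hq hne
    rw [hdc, hdc]
    exact Set.disjoint_left.2 fun x hx hx' => Set.disjoint_left.1 (hdisj p hp.1 q hq.1 hne)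
      (mem_coords_finsetsOfTriple.1 hx) (mem_coords_finsetsOfTriple.1 hx')
  -- No coordinate of a member of `Z'` is `∞`.
  have hcoe : ∀ p ∈ Z', ∀ y ∈ tripleCoords p, ∃ x : (guessingSystem S d).Space, ↑x = y :=
    fun p hp y hy => OnePoint.ne_infty_iff_exists.1 fun h => hp.2 (h ▸ hy)
  have hinj : InjOn c Z' := by
    intro p hp q hq hpq
    by_contra hne
    have hmem : p.1 ⟨0, Nat.pos_of_ne_zero h₁⟩ ∈ tripleCoords p := .inl (.inl ⟨_, rfl⟩)
    obtain ⟨x, hx⟩ := hcoe p hp _ hmem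
    have hx' : x ∈ (d (c p)).coords := by
      rw [hdc]
      exact mem_coords_finsetsOfTriple.2 (hx ▸ hmem)
    exact Set.disjoint_left.1 (hdisj' p hp q hq hne) hx' (hpq ▸ hx')
  obtain ⟨α, hα, hSα⟩ := exists_good_subset (S := S) (d := d) hc hS (𝒵 := c '' Z')
    (fun h => hZ' (countable_of_injective_of_countable_image hinj h))
    (by
      rintro _ ⟨p, hp, rfl⟩
      rw [hdc]
      obtain ⟨h12, h13, h23⟩ := hZ hp.1
      exact ⟨disjoint_finsetOfTuple h12, disjoint_finsetOfTuple h13, disjoint_finsetOfTuple h23⟩)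
    (by
      rintro _ ⟨p, hp, rfl⟩ _ ⟨q, hq, rfl⟩ hne
      exact hdisj' p hp q hq fun h => hne (h ▸ rfl))
  choose u huZ hu using fun ξ : S α => hSα ξ.2
  have hdu : ∀ ξ : S α, d ξ = finsetsOfTriple (u ξ) := fun ξ => by rw [← hu ξ, hdc]
  let a : Bool → (guessingSystem S d).Space := fun b => (α, b)
  have hne : (cofinite : Filter (S α)).NeBot := (mem_good.1 hα).1.neBot_cofinite
  have t₁ : ∀ i, Tendsto (fun ξ => (u ξ).1 i) cofinite (𝓝 (a false : OnePoint _)) := by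
    intro i
    choose v hv using fun ξ => hcoe (u ξ) (huZ ξ) ((u ξ).1 i) (.inl (.inl ⟨i, rfl⟩))
    simp only [← hv]
    refine (OnePoint.continuous_coe.tendsto _).comp (tendsto_of_mem_component hα fun ξ => ?_)
    rw [hdu]
    exact mem_finsetOfTuple.2 ⟨i, (hv ξ).symm⟩
  have t₂ : ∀ i, Tendsto (fun ξ => (u ξ).2.1 i) cofinite (𝓝 (a true : OnePoint _)) := by
    intro i
    choose v hv using fun ξ => hcoe (u ξ) (huZ ξ) ((u ξ).2.1 i) (.inl (.inr ⟨i, rfl⟩))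
    simp only [← hv]
    refine (OnePoint.continuous_coe.tendsto _).comp (tendsto_of_mem_component hα fun ξ => ?_)
    rw [hdu]
    exact mem_finsetOfTuple.2 ⟨i, (hv ξ).symm⟩
  have t₃ : ∀ i, Tendsto (fun ξ => (u ξ).2.2 i) cofinite (𝓝 OnePoint.infty) := by
    intro i
    choose v hv using fun ξ => hcoe (u ξ) (huZ ξ) ((u ξ).2.2 i) (.inr ⟨i, rfl⟩)
    simp only [← hv]
    refine OnePoint.tendsto_coe_infty.comp ?_
    rw [coclosedCompact_eq_cocompact]
    refine tendsto_cocompact_of_mem_last hα fun ξ => ?_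
    rw [hdu]
    exact mem_finsetOfTuple.2 ⟨i, (hv ξ).symm⟩
  refine ⟨(fun _ => a false, fun _ => a true, fun _ => OnePoint.infty), ⟨⟨?_, ?_, ?_⟩,
    fun _ _ => rfl, fun _ _ => rfl, fun _ => rfl⟩, accPt_of_tendsto (u := u)
    ((tendsto_pi_nhds.2 t₁).prodMk_nhds ((tendsto_pi_nhds.2 t₂).prodMk_nhds
      (tendsto_pi_nhds.2 t₃))) (fun ξ h => ?_) fun ξ => (huZ ξ).1⟩
  · refine Set.disjoint_left.2 ?_
    rintro _ ⟨_, rfl⟩ ⟨_, h⟩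
    exact Bool.noConfusion (congrArg Prod.snd (OnePoint.coe_injective h))
  · refine Set.disjoint_left.2 ?_
    rintro _ ⟨_, rfl⟩ ⟨_, h⟩
    exact OnePoint.infty_ne_coe _ h
  · refine Set.disjoint_left.2 ?_
    rintro _ ⟨_, rfl⟩ ⟨_, h⟩
    exact OnePoint.infty_ne_coe _ h
  -- The limit has the coordinate `∞` since `m₃ ≠ 0`, so it differs from all members of `Z'`.
  · refine (huZ ξ).2 (.inr ⟨⟨0, Nat.pos_of_ne_zero h₃⟩, ?_⟩)
    rw [h]

end Diversity

theorem theorem3p2 (hclub : ClubPrinciple) :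
    ∃ (L : Type) (_ : TopologicalSpace L),
      LocallyCompactSpace L ∧ T2Space L ∧ HasFiniteToOneSurjection L ∧
        HasHeight L Ordinal.omega0 ∧ IsThreeDiverseAtBoundary L := by
  obtain ⟨S, hS⟩ := hclub.exists_ladders
  obtain ⟨d⟩ := nonempty_equiv_finsetTriple (ω₁ : Ordinal.{0}).ToType
  refine ⟨(guessingSystem S d).Space, inferInstance, inferInstance, inferInstance, ?_, ?_,
    isThreeDiverseAtBoundary countable_Iic_toType_omega_one hS⟩
  · let e : (ω₁ : Ordinal.{0}).ToType ≃o Iio (ω₁ : Ordinal.{0}) := Ordinal.ToType.mk.symm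
    refine ⟨fun x => e (LadderSystem.level x), LadderSystem.continuous_level e, fun α =>
      ⟨(e.symm α, false), e.apply_symm_apply α⟩, fun α => ?_⟩
    refine ((Set.finite_singleton (e.symm α)).prod (Set.finite_univ (α := Bool))).subset ?_
    rintro x rfl
    exact ⟨(e.symm_apply_apply _).symm, trivial⟩
  · refine hasHeight_omega0 (fun n => ?_) (fun x => height S d (LadderSystem.level x))
      exists_nhds_height_lt
    obtain ⟨γ⟩ : Nonempty (ω₁ : Ordinal.{0}).ToType := inferInstance
    obtain ⟨x, hx, -⟩ := exists_mem_cbDerivative_lt_level countable_Iic_toType_omega_one hS n γ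
    exact ⟨x, hx⟩
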